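/- Let $\Gamma$ be a distance-regular graph (finite, simple, undirected, connected) with vertex set $X$, path-length distance $\partial$ and diameter $D\ge 3$; that is, for all $0\le h,i,j\le D$ the number of $z\in X$ with $\partial(y,z)=i$ and $\partial(z,w)=j$ is the same for all $y,w\in X$ with $\partial(y,w)=h$. Let $V=\mathbb{C}^X$ (column vectors) with the Hermitian inner product $\langle u,w\rangle=u^t\overline{w}$, let $A\in\mathrm{Mat}_X(\mathbb{C})$ be the adjacency matrix of $\Gamma$, and let $\mathbf{M}$ be the Bose-Mesner algebra, i.e. the subalgebra of $\mathrm{Mat}_X(\mathbb{C})$ generated by $A$. Fix $x\in X$. For $0\le i\le D$ let $E_i^*\in\mathrm{Mat}_X(\mathbb{C})$ be the diagonal matrix whose $(y,y)$ entry is $1$ if $\partial(x,y)=i$ and $0$ otherwise, and let $s_i\in V$ be the sum of the standard basis vectors $\hat y$ over all $y\in X$ with $\partial(x,y)=i$. Let $\mathbf{T}$ be the Terwilliger algebra, i.e. the subalgebra of $\mathrm{Mat}_X(\mathbb{C})$ generated by $A,E_0^*,\dots,E_D^*$. A $\mathbf{T}$-module is a subspace $W\subseteq V$ with $\mathbf{T}W\subseteq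 W$; it is irreducible if $W\ne 0$ and it contains no $\mathbf{T}$-modules other than $0$ and $W$. The endpoint of an irreducible $\mathbf{T}$-module $W$ is $\min\{i : 0\le i\le D,\ E_i^*W\ne 0\}$, and $W$ is thin if $\dim E_i^*W\le 1$ for $0\le i\le D$. Let $v$ be a nonzero vector in $E_1^*V$ orthogonal to $s_1$, and let $(\mathbf{M};v)=\{P\in\mathbf{M} : Pv\in E_D^*V\}$, a subspace of $\mathbf{M}$. Then the following are equivalent: (i) $\dim(\mathbf{M};v)\ge 2$; (ii) $v$ is contained in a thin irreducible $\mathbf{T}$-module with endpoint $1$. Moreover, if (i) and (ii) hold, then $\dim(\mathbf{M};v)=2$. -/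

import Mathlib

noncomputable section

open scoped Matrix

namespace DRG

variable {X : Type*} [Fintype X] [DecidableEq X]

/-- A finite graph (simple and undirected) is distance-regular if it is connected and, for all
`h, i, j` at most the diameter, the number of `z` with `∂(x,z) = i` and `∂(z,y) = j` is the same
for all pairs `(x, y)` at distance `h`. -/
structure IsDistanceRegular (G : SimpleGraph X) : Prop where
  connected : G.Connected
  card_eq : ∀ h i j : ℕ, h ≤ G.diam → i ≤ G.diam → j ≤ G.diam →
    ∀ x y x' y' : X, G.dist x y = h → G.dist x' y' = h →
      (Finset.univ.filter fun z => G.dist x z = i ∧ G.dist z y = j).card =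
        (Finset.univ.filter fun z => G.dist x' z = i ∧ G.dist z y' = j).card

/-- The Hermitean inner product `⟨u, v⟩ = uᵗ v̄` on `V = ℂ^X`. -/
def hermInner (u v : X → ℂ) : ℂ := u ⬝ᵥ star v

/-- The Bose-Mesner algebra `M`: the subalgebra of `Mat_X(ℂ)` generated by the adjacency
matrix. -/
def boseMesner (G : SimpleGraph X) [DecidableRel G.Adj] : Subalgebra ℂ (Matrix X X ℂ) :=
  Algebra.adjoin ℂ {G.adjMatrix ℂ}

/-- The `i`th dual idempotent `E_i^*` with respect to `x`. -/
def dualIdempotent (G : SimpleGraph X) (x : X) (i : ℕ) : Matrix X X ℂ :=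
  Matrix.diagonal fun y => if G.dist x y = i then 1 else 0

/-- The subspace `E_i^* W` of `V`, for a subspace `W` of `V`. -/
def dualPart (G : SimpleGraph X) (x : X) (i : ℕ) (W : Submodule ℂ (X → ℂ)) :
    Submodule ℂ (X → ℂ) :=
  W.map (dualIdempotent G x i).mulVecLin

/-- The `i`th subconstituent `E_i^* V` with respect to `x`. -/
def subconstituent (G : SimpleGraph X) (x : X) (i : ℕ) : Submodule ℂ (X → ℂ) :=
  dualPart G x i ⊤

/-- The vector `s_i`: the sum of `ŷ` over the vertices `y` at distance `i` from `x`. -/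
def sphereVec (G : SimpleGraph X) (x : X) (i : ℕ) : X → ℂ :=
  ∑ y ∈ Finset.univ.filter (fun y => G.dist x y = i), Pi.single y 1

/-- The Terwilliger algebra `T = T(x)`: the subalgebra of `Mat_X(ℂ)` generated by
`A, E_0^*, …, E_D^*`. -/
def terwilliger (G : SimpleGraph X) [DecidableRel G.Adj] (x : X) :
    Subalgebra ℂ (Matrix X X ℂ) :=
  Algebra.adjoin ℂ ({G.adjMatrix ℂ} ∪ {B | ∃ i : ℕ, i ≤ G.diam ∧ B = dualIdempotent G x i})

/-- A `T`-module: a subspace `W` of `V` with `T W ⊆ W`. -/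
def IsTModule (G : SimpleGraph X) [DecidableRel G.Adj] (x : X)
    (W : Submodule ℂ (X → ℂ)) : Prop :=
  ∀ B ∈ terwilliger G x, ∀ w ∈ W, B *ᵥ w ∈ W

/-- A `T`-module is irreducible if it is nonzero and contains no `T`-modules other than `0` and
itself. -/
structure IsIrreducibleTModule (G : SimpleGraph X) [DecidableRel G.Adj] (x : X)
    (W : Submodule ℂ (X → ℂ)) : Prop where
  isTModule : IsTModule G x W
  ne_bot : W ≠ ⊥
  eq_bot_or_eq : ∀ U : Submodule ℂ (X → ℂ), U ≤ W → IsTModule G x U → U = ⊥ ∨ U = W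

/-- `r` is the endpoint of `W`: the minimal `i` with `0 ≤ i ≤ D` and `E_i^* W ≠ 0`. -/
def HasEndpoint (G : SimpleGraph X) (x : X) (W : Submodule ℂ (X → ℂ)) (r : ℕ) : Prop :=
  IsLeast {i : ℕ | i ≤ G.diam ∧ dualPart G x i W ≠ ⊥} r

/-- `W` is thin: `dim E_i^* W ≤ 1` for `0 ≤ i ≤ D`. -/
def IsThin (G : SimpleGraph X) (x : X) (W : Submodule ℂ (X → ℂ)) : Prop :=
  ∀ i : ℕ, i ≤ G.diam → Module.finrank ℂ (dualPart G x i W) ≤ 1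

/-- The subspace `(M; v) = {P ∈ M : P v ∈ E_D^* V}` of `M`. -/
def pairSpace (G : SimpleGraph X) [DecidableRel G.Adj] (x : X) (v : X → ℂ) :
    Submodule ℂ (Matrix X X ℂ) where
  carrier := {P | P ∈ boseMesner G ∧ P *ᵥ v ∈ subconstituent G x G.diam}
  zero_mem' := ⟨zero_mem _, by rw [Matrix.zero_mulVec]; exact zero_mem _⟩
  add_mem' := fun hP hQ => ⟨add_mem hP.1 hQ.1, by
    rw [Matrix.add_mulVec]; exact add_mem hP.2 hQ.2⟩
  smul_mem' := fun c _ hP => ⟨Subalgebra.smul_mem _ hP.1 c, by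
    rw [Matrix.smul_mulVec]; exact Submodule.smul_mem _ c hP.2⟩

end DRG

end

/-! Elements of `M` are exactly matrices P whose entries P(y, z) = ρ(∂(y, z)) depend only on
distance. As v lives on the sphere of radius 1 and sums to zero, Pv at a vertex y at distance i from
x equals (ρ(i-1) - ρ(i)) up(y) + (ρ(i+1) - ρ(i)) down(y), where up = `upVec` and down = `downVec`.
With δ(i) = ρ(i-1) - ρ(i), membership in `(M; v)` therefore means δ(i) up = δ(i+1) down on each
sphere 1 ≤ i < D; dimension at least 2 supplies a nonconstant ρ, that is, δ not identically zero on
1, …, D.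

Such a δ forces down to be proportional to up on every sphere, with up nonzero on spheres 1, …, D-1
(`exists_downVec_eq_mul_upVec`). The proof evaluates ⟨A_i v, A_j v⟩ = ⟨v, A_i A_j v⟩ for j = i+1 and
j = i+2, and splits on whether ⟨v, E_1^* A_2 v⟩ vanishes. Proportionality makes the span of the
vectors E_i^* up a thin irreducible module; nonvanishing of up lets ρ be recovered from ρ(D) and
ρ(D-1), so the dimension is at most 2.

Conversely, in a thin module of endpoint 1, Pv has components only on spheres 1, …, D. Killing those
on 1, …, D-1 costs at most D-1 linear conditions on `M`, whose dimension is at least D+1. -/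

namespace DRG

/-! ### Distance matrices and the Bose-Mesner algebra -/

variable {X : Type*} {G : SimpleGraph X}

/-- The matrix whose `(y, z)` entry is `ρ (∂(y, z))`. -/
noncomputable def radial (G : SimpleGraph X) (ρ : ℕ → ℂ) : Matrix X X ℂ :=
  Matrix.of fun y z => ρ (G.dist y z)

@[simp] theorem radial_apply (ρ : ℕ → ℂ) (y z : X) : radial G ρ y z = ρ (G.dist y z) := rfl

theorem dist_le_diam_of_connected [Finite X] (hc : G.Connected) (y z : X) : G.dist y z ≤ G.diam :=
  have := hc.nonempty
  SimpleGraph.dist_le_diam (SimpleGraph.connected_iff_ediam_ne_top.1 hc)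

theorem exists_dist_eq_and_dist_eq (hc : G.Connected) {y w : X} {m n : ℕ}
    (h : G.dist y w = m + n) : ∃ z, G.dist y z = m ∧ G.dist z w = n := by
  obtain ⟨p, hp⟩ := hc.exists_walk_length_eq_dist y w
  have h1 := SimpleGraph.dist_le (p.take m)
  have h2 := SimpleGraph.dist_le (p.drop m)
  have h3 := hc.dist_triangle (u := y) (v := p.getVert m) (w := w)
  rw [SimpleGraph.Walk.take_length] at h1
  rw [SimpleGraph.Walk.drop_length] at h2
  exact ⟨p.getVert m, by omega, by omega⟩

theorem exists_dist_eq [Finite X] (hc : G.Connected) {h : ℕ} (hh : h ≤ G.diam) :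
    ∃ y w, G.dist y w = h := by
  have := hc.nonempty
  obtain ⟨y, w, hyw⟩ := G.exists_dist_eq_diam
  obtain ⟨z, hz, -⟩ := exists_dist_eq_and_dist_eq hc (m := h) (n := G.diam - h) (y := y) (w := w)
    (by omega)
  exact ⟨y, z, hz⟩

theorem exists_eq_radial {B : Matrix X X ℂ}
    (hB : ∀ y w y' w', G.dist y w = G.dist y' w' → B y w = B y' w') : ∃ ρ, B = radial G ρ := by
  classical
  refine ⟨fun h => if hh : ∃ p : X × X, G.dist p.1 p.2 = h then B hh.choose.1 hh.choose.2 else 0,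
    ?_⟩
  ext y w
  have hh : ∃ p : X × X, G.dist p.1 p.2 = G.dist y w := ⟨(y, w), rfl⟩
  simp only [radial_apply, dif_pos hh]
  exact (hB _ _ _ _ hh.choose_spec).symm

/-- The `i`th distance matrix. -/
noncomputable def distMatrix (G : SimpleGraph X) (i : ℕ) : Matrix X X ℂ :=
  radial G (Pi.single i 1)

theorem distMatrix_apply (i : ℕ) (y z : X) :
    distMatrix G i y z = if G.dist y z = i then 1 else 0 := by
  simp [distMatrix, Pi.single_apply]

theorem adjMatrix_eq [DecidableRel G.Adj] : G.adjMatrix ℂ = distMatrix G 1 := by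
  ext y z
  rw [distMatrix_apply, SimpleGraph.adjMatrix_apply]
  simp [SimpleGraph.dist_eq_one_iff_adj]

variable [Fintype X]

theorem distMatrix_mul_apply (i j : ℕ) (y w : X) :
    (distMatrix G i * distMatrix G j) y w =
      ((Finset.univ.filter fun z => G.dist y z = i ∧ G.dist z w = j).card : ℂ) := by
  simp only [Matrix.mul_apply, distMatrix_apply, Finset.card_filter, Nat.cast_sum]
  refine Finset.sum_congr rfl fun z _ => ?_
  by_cases h1 : G.dist y z = i <;> by_cases h2 : G.dist z w = j <;> simp [h1, h2]

/-- Group the z by the pair of distances (∂(y, z), ∂(z, w)). Connectedness keeps both at most D, the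
range in which the counts are constant. -/
theorem sum_dist_mul_dist (hG : IsDistanceRegular G) (ρ σ : ℕ → ℂ) {y w y' w' : X}
    (h : G.dist y w = G.dist y' w') :
    ∑ z, ρ (G.dist y z) * σ (G.dist z w) = ∑ z, ρ (G.dist y' z) * σ (G.dist z w') := by
  have key : ∀ y w : X, ∑ z, ρ (G.dist y z) * σ (G.dist z w) =
      ∑ p ∈ Finset.range (G.diam + 1) ×ˢ Finset.range (G.diam + 1), ρ p.1 * σ p.2 *
        ((Finset.univ.filter fun z => G.dist y z = p.1 ∧ G.dist z w = p.2).card : ℂ) := by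
    intro y w
    rw [← Finset.sum_fiberwise_of_maps_to (g := fun z => (G.dist y z, G.dist z w))
      (t := Finset.range (G.diam + 1) ×ˢ Finset.range (G.diam + 1))]
    · refine Finset.sum_congr rfl fun p _ => ?_
      rw [mul_comm, ← nsmul_eq_mul, ← Finset.sum_const]
      refine Finset.sum_congr ?_ ?_
      · ext z
        simp [Prod.ext_iff]
      · intro z hz
        simp only [Finset.mem_filter] at hz
        rw [hz.2.1, hz.2.2]
    · intro z _
      simp only [Finset.mem_product, Finset.mem_range, Nat.lt_succ_iff]
      exact ⟨dist_le_diam_of_connected hG.connected _ _,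
        dist_le_diam_of_connected hG.connected _ _⟩
  rw [key, key]
  refine Finset.sum_congr rfl fun p hp => ?_
  simp only [Finset.mem_product, Finset.mem_range, Nat.lt_succ_iff] at hp
  rw [hG.card_eq (G.dist y w) p.1 p.2 (dist_le_diam_of_connected hG.connected _ _) hp.1 hp.2
    y w y' w' rfl h.symm]

theorem exists_radial_mul (hG : IsDistanceRegular G) (ρ σ : ℕ → ℂ) :
    ∃ τ, radial G ρ * radial G σ = radial G τ :=
  exists_eq_radial fun y w y' w' h => by
    simpa [Matrix.mul_apply] using sum_dist_mul_dist hG ρ σ h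

/-- `A_i A_j = ∑_h p^h_{ij} A_h` with `p^h_{ij} ≠ 0` iff some triple realizes it. -/
theorem exists_distMatrix_mul (hG : IsDistanceRegular G) (i j : ℕ) :
    ∃ f : ℕ → ℂ, distMatrix G i * distMatrix G j = radial G f ∧
      ∀ y w, f (G.dist y w) ≠ 0 ↔ ∃ z, G.dist y z = i ∧ G.dist z w = j := by
  obtain ⟨f, hf⟩ := exists_radial_mul hG (Pi.single i 1) (Pi.single j 1)
  refine ⟨f, hf, fun y w => ?_⟩
  rw [← radial_apply f, ← hf, ← distMatrix, ← distMatrix, distMatrix_mul_apply,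
    Nat.cast_ne_zero, Finset.card_ne_zero, Finset.filter_nonempty_iff]
  simp

variable [DecidableEq X]

theorem exists_eq_radial_of_mem_boseMesner [DecidableRel G.Adj] (hG : IsDistanceRegular G)
    {P : Matrix X X ℂ} (hP : P ∈ boseMesner G) : ∃ ρ, P = radial G ρ := by
  refine Algebra.adjoin_induction ?_ ?_ ?_ ?_ hP
  · rintro _ rfl
    exact ⟨_, adjMatrix_eq⟩
  · intro r
    refine ⟨Pi.single 0 r, ?_⟩
    ext y z
    simp [Matrix.algebraMap_matrix_apply, Pi.single_apply, hG.connected.dist_eq_zero_iff]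
  · rintro _ _ - - ⟨ρ, rfl⟩ ⟨σ, rfl⟩
    exact ⟨ρ + σ, by ext; simp⟩
  · rintro _ _ - - ⟨ρ, rfl⟩ ⟨σ, rfl⟩
    exact exists_radial_mul hG ρ σ

/-- In the expansion of A_1 A_{i+1} the coefficient of A_{i+2} is nonzero and all later ones vanish,
so A_{i+2} can be solved for. -/
theorem distMatrix_mem_boseMesner [DecidableRel G.Adj] (hG : IsDistanceRegular G) {i : ℕ}
    (hi : i ≤ G.diam) : distMatrix G i ∈ boseMesner G := by
  have hc := hG.connected
  induction i using Nat.strong_induction_on with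
  | _ i ih =>
  rcases i with _ | _ | i
  · convert one_mem (boseMesner G)
    ext y z
    simp [distMatrix_apply, Matrix.one_apply, hc.dist_eq_zero_iff]
  · exact adjMatrix_eq (G := G) ▸ Algebra.subset_adjoin rfl
  · obtain ⟨f, hf, hf0⟩ := exists_distMatrix_mul hG 1 (i + 1)
    obtain ⟨y, w, hyw⟩ := exists_dist_eq hc hi
    have hne : f (i + 2) ≠ 0 := by
      rw [← hyw, hf0]
      exact exists_dist_eq_and_dist_eq hc (by omega)
    have hsum : radial G f = ∑ j ∈ Finset.range (i + 3), f j • distMatrix G j := by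
      ext y z
      have : i + 2 < G.dist y z → f (G.dist y z) = 0 := by
        intro hlt
        by_contra hcon
        obtain ⟨u, h1, h2⟩ := (hf0 _ _).1 hcon
        have := hc.dist_triangle (u := y) (v := u) (w := z)
        omega
      simp only [radial_apply, Matrix.sum_apply, Matrix.smul_apply, distMatrix_apply, smul_eq_mul,
        mul_ite, mul_one, mul_zero, Finset.sum_ite_eq, Finset.mem_range]
      split_ifs with h
      · rfl
      · exact this (by omega)
    rw [Finset.sum_range_succ, ← hf] at hsum
    have : distMatrix G (i + 2) = (f (i + 2))⁻¹ • (distMatrix G 1 * distMatrix G (i + 1) -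
        ∑ j ∈ Finset.range (i + 2), f j • distMatrix G j) := by
      rw [hsum, add_sub_cancel_left, smul_smul, inv_mul_cancel₀ hne, one_smul]
    rw [this]
    refine Subalgebra.smul_mem _ (sub_mem (mul_mem (ih 1 (by omega) (by omega))
      (ih (i + 1) (by omega) (by omega))) (sum_mem fun j hj => Subalgebra.smul_mem _ ?_ _)) _
    rw [Finset.mem_range] at hj
    exact ih j (by omega) (by omega)

theorem diam_add_one_le_finrank_boseMesner [DecidableRel G.Adj] (hG : IsDistanceRegular G) :
    G.diam + 1 ≤ Module.finrank ℂ (boseMesner G) := by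
  let b : Fin (G.diam + 1) → boseMesner G := fun i =>
    ⟨distMatrix G i, distMatrix_mem_boseMesner hG (by omega)⟩
  have hb : LinearIndependent ℂ b := by
    rw [Fintype.linearIndependent_iff]
    intro g hg i
    obtain ⟨y, w, hyw⟩ := exists_dist_eq hG.connected (Nat.le_of_lt_succ i.2)
    have h := congrArg (fun P : boseMesner G => (P : Matrix X X ℂ) y w) hg
    simpa [b, Matrix.sum_apply, distMatrix_apply, hyw, Fin.val_inj] using h
  simpa using hb.fintype_card_le_finrank

end DRG

/-! ### The up and down parts of v -/

namespace DRG

open scoped Matrix ComplexOrder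

variable {X : Type*} [Fintype X] {G : SimpleGraph X} {x : X} {v : X → ℂ}

/-- The vector `∑_i E_i^* A_{i-1} v`. -/
noncomputable def upVec (G : SimpleGraph X) (x : X) (v : X → ℂ) (y : X) : ℂ :=
  ∑ z, if G.dist y z + 1 = G.dist x y then v z else 0

/-- The vector `∑_i E_i^* A_{i+1} v`. -/
noncomputable def downVec (G : SimpleGraph X) (x : X) (v : X → ℂ) (y : X) : ℂ :=
  ∑ z, if G.dist y z = G.dist x y + 1 then v z else 0

theorem upVec_eq_zero {y : X} (h : G.dist x y = 0) : upVec G x v y = 0 :=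
  Finset.sum_eq_zero fun z _ => if_neg (by omega)

theorem upVec_eq_self (hc : G.Connected) {y : X} (h : G.dist x y = 1) :
    upVec G x v y = v y := by
  classical
  simp [upVec, h, hc.dist_eq_zero_iff]

theorem downVec_eq_zero (hc : G.Connected) {y : X} (h : G.dist x y = G.diam) :
    downVec G x v y = 0 :=
  Finset.sum_eq_zero fun z _ => if_neg (by
    have := dist_le_diam_of_connected hc y z
    omega)

theorem downVec_self (hc : G.Connected) (hv : ∀ z, G.dist x z ≠ 1 → v z = 0)
    (hs : ∑ z, v z = 0) {y : X} (h : G.dist x y = 0) : downVec G x v y = 0 := by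
  obtain rfl := hc.dist_eq_zero_iff.1 h
  rw [← hs, downVec]
  refine Finset.sum_congr rfl fun z _ => ?_
  rw [h]
  split_ifs with h1
  · rfl
  · exact (hv z h1).symm

/-- Vertices z of the first sphere lie at distance i-1, i or i+1 from y, where i = ∂(x, y).
Subtracting ρ(i) ∑ v = 0 removes the middle class. The truncation of i-1 at i = 0 is harmless: that
coefficient is zero. -/
theorem radial_mulVec_apply (hc : G.Connected) (hv : ∀ z, G.dist x z ≠ 1 → v z = 0)
    (hs : ∑ z, v z = 0) (ρ : ℕ → ℂ) (y : X) :
    (radial G ρ *ᵥ v) y = (ρ (G.dist x y - 1) - ρ (G.dist x y)) * upVec G x v y +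
      (ρ (G.dist x y + 1) - ρ (G.dist x y)) * downVec G x v y := by
  have h : (radial G ρ *ᵥ v) y - ρ (G.dist x y) * ∑ z, v z =
      (ρ (G.dist x y - 1) - ρ (G.dist x y)) * upVec G x v y +
      (ρ (G.dist x y + 1) - ρ (G.dist x y)) * downVec G x v y := by
    simp only [Matrix.mulVec, dotProduct, radial_apply, upVec, downVec, Finset.mul_sum,
      ← Finset.sum_add_distrib, ← Finset.sum_sub_distrib]
    refine Finset.sum_congr rfl fun z _ => ?_
    by_cases hz : G.dist x z = 1
    · have h1 := hc.dist_triangle (u := x) (v := z) (w := y)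
      have h2 := hc.dist_triangle (u := y) (v := x) (w := z)
      rw [G.dist_comm (u := z) (v := y)] at h1
      rw [G.dist_comm (u := y) (v := x)] at h2
      obtain h | h | h : G.dist y z + 1 = G.dist x y ∨ G.dist y z = G.dist x y ∨
        G.dist y z = G.dist x y + 1 := by omega
      · rw [if_pos h, if_neg (by omega), ← h, Nat.add_sub_cancel]
        ring
      · rw [if_neg (by omega), if_neg (by omega), h]
        ring
      · rw [if_neg (by omega), if_pos h, h]
        ring
    · simp [hv z hz]
  rwa [hs, mul_zero, sub_zero] at h

theorem distMatrix_mulVec_apply_of_lt (hc : G.Connected) (hv : ∀ z, G.dist x z ≠ 1 → v z = 0)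
    (hs : ∑ z, v z = 0) {i : ℕ} {y : X} (h : G.dist x y = i + 1) :
    (distMatrix G i *ᵥ v) y = upVec G x v y := by
  have h1 : i + 1 + 1 ≠ i := by omega
  simp [distMatrix, radial_mulVec_apply hc hv hs, h, h1]

theorem distMatrix_mulVec_apply_of_gt (hc : G.Connected) (hv : ∀ z, G.dist x z ≠ 1 → v z = 0)
    (hs : ∑ z, v z = 0) {i : ℕ} {y : X} (h : G.dist x y + 1 = i) :
    (distMatrix G i *ᵥ v) y = downVec G x v y := by
  have h1 : G.dist x y - 1 ≠ G.dist x y + 1 := by omega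
  simp [distMatrix, radial_mulVec_apply hc hv hs, ← h, h1]

theorem distMatrix_mulVec_apply_eq_zero (hc : G.Connected)
    (hv : ∀ z, G.dist x z ≠ 1 → v z = 0) (hs : ∑ z, v z = 0) {i : ℕ} {y : X}
    (h : G.dist x y + 1 < i ∨ i + 1 < G.dist x y) :
    (distMatrix G i *ᵥ v) y = 0 := by
  have h1 : G.dist x y - 1 ≠ i := by omega
  have h2 : G.dist x y ≠ i := by omega
  have h3 : G.dist x y + 1 ≠ i := by omega
  simp [distMatrix, radial_mulVec_apply hc hv hs, h1, h2, h3]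

/-! ### Inner products of the vectors A_i v -/

theorem triangle_of_ne_zero (hG : IsDistanceRegular G) {i j h : ℕ} {f : ℕ → ℂ}
    (hf : ∀ y w, f (G.dist y w) ≠ 0 ↔ ∃ z, G.dist y z = i ∧ G.dist z w = j)
    (hh : h ≤ G.diam) (h0 : f h ≠ 0) : h ≤ i + j ∧ i ≤ h + j ∧ j ≤ h + i := by
  obtain ⟨y, w, rfl⟩ := exists_dist_eq hG.connected hh
  obtain ⟨z, rfl, rfl⟩ := (hf y w).1 h0
  have h1 := hG.connected.dist_triangle (u := y) (v := z) (w := w)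
  have h2 := hG.connected.dist_triangle (u := y) (v := w) (w := z)
  have h3 := hG.connected.dist_triangle (u := z) (v := y) (w := w)
  rw [G.dist_comm (u := w) (v := z)] at h2
  rw [G.dist_comm (u := z) (v := y)] at h3
  omega

omit [Fintype X] in
theorem distMatrix_conjTranspose (i : ℕ) : (distMatrix G i)ᴴ = distMatrix G i := by
  ext y z
  rw [Matrix.conjTranspose_apply, distMatrix_apply, distMatrix_apply, G.dist_comm]
  split_ifs <;> simp

theorem mulVec_dotProduct_star_mulVec (B C : Matrix X X ℂ) (u w : X → ℂ) :
    (B *ᵥ u) ⬝ᵥ star (C *ᵥ w) = u ⬝ᵥ star ((Bᴴ * C) *ᵥ w) := by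
  rw [← Matrix.mulVec_mulVec, Matrix.star_mulVec Bᴴ, Matrix.conjTranspose_conjTranspose,
    dotProduct_comm u, ← Matrix.dotProduct_mulVec, dotProduct_comm]

/-- `⟨v, E_1^* A_2 v⟩`. -/
noncomputable def localForm (G : SimpleGraph X) (x : X) (v : X → ℂ) : ℂ :=
  v ⬝ᵥ star (downVec G x v)

/-- Move A_i across the inner product and expand A_i A_j. Only the first sphere matters, and there
`upVec` is v itself. -/
theorem exists_dotProduct_distMatrix (hG : IsDistanceRegular G)
    (hv : ∀ z, G.dist x z ≠ 1 → v z = 0) (hs : ∑ z, v z = 0) (i j : ℕ) :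
    ∃ f : ℕ → ℂ, (∀ y w, f (G.dist y w) ≠ 0 ↔ ∃ z, G.dist y z = i ∧ G.dist z w = j) ∧
      (distMatrix G i *ᵥ v) ⬝ᵥ star (distMatrix G j *ᵥ v) =
        star (f 0 - f 1) * (v ⬝ᵥ star v) + star (f 2 - f 1) * localForm G x v := by
  obtain ⟨f, hf, hf0⟩ := exists_distMatrix_mul hG i j
  refine ⟨f, hf0, ?_⟩
  rw [mulVec_dotProduct_star_mulVec, distMatrix_conjTranspose, hf, localForm]
  simp only [dotProduct, Finset.mul_sum, ← Finset.sum_add_distrib]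
  refine Finset.sum_congr rfl fun z _ => ?_
  by_cases hz : G.dist x z = 1
  · rw [Pi.star_apply, radial_mulVec_apply hG.connected hv hs, hz, upVec_eq_self hG.connected hz]
    simp only [Pi.star_apply, star_add, star_mul']
    ring
  · simp [hv z hz]

/-- The triangle inequality kills the coefficients of A_0 and A_1 in A_i A_{i+2}, while that of A_2
survives. -/
theorem exists_dotProduct_eq_mul_localForm (hG : IsDistanceRegular G)
    (hv : ∀ z, G.dist x z ≠ 1 → v z = 0) (hs : ∑ z, v z = 0) {i : ℕ} (hi : i + 2 ≤ G.diam) :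
    ∃ c : ℂ, c ≠ 0 ∧ (distMatrix G i *ᵥ v) ⬝ᵥ star (distMatrix G (i + 2) *ᵥ v) =
        c * localForm G x v := by
  obtain ⟨f, hf, h⟩ := exists_dotProduct_distMatrix hG hv hs i (i + 2)
  have h0 : f 0 = 0 := by
    by_contra hcon
    have := triangle_of_ne_zero hG hf (by omega) hcon
    omega
  have h1 : f 1 = 0 := by
    by_contra hcon
    have := triangle_of_ne_zero hG hf (by omega) hcon
    omega
  have h2 : f 2 ≠ 0 := by
    obtain ⟨a, b, hab⟩ := exists_dist_eq hG.connected hi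
    obtain ⟨w, haw, hwb⟩ := exists_dist_eq_and_dist_eq hG.connected hab
    rw [← hwb, hf]
    exact ⟨a, G.dist_comm ▸ haw, hab⟩
  exact ⟨star (f 2), star_ne_zero.2 h2, by rw [h, h0, h1]; simp⟩

theorem dotProduct_ne_zero_of_localForm_eq_zero (hG : IsDistanceRegular G)
    (hv0 : v ≠ 0) (hv : ∀ z, G.dist x z ≠ 1 → v z = 0) (hs : ∑ z, v z = 0)
    (hl : localForm G x v = 0) {i : ℕ} (hi : i + 1 ≤ G.diam) :
    (distMatrix G i *ᵥ v) ⬝ᵥ star (distMatrix G (i + 1) *ᵥ v) ≠ 0 := by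
  obtain ⟨f, hf, h⟩ := exists_dotProduct_distMatrix hG hv hs i (i + 1)
  have h0 : f 0 = 0 := by
    by_contra hcon
    have := triangle_of_ne_zero hG hf (by omega) hcon
    omega
  have h1 : f 1 ≠ 0 := by
    obtain ⟨a, b, hab⟩ := exists_dist_eq hG.connected hi
    obtain ⟨w, haw, hwb⟩ := exists_dist_eq_and_dist_eq hG.connected hab
    rw [← hwb, hf]
    exact ⟨a, G.dist_comm ▸ haw, hab⟩
  rw [h, hl, h0, mul_zero, add_zero]
  refine mul_ne_zero (star_ne_zero.2 (by simpa using h1)) ?_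
  rwa [Ne, dotProduct_self_star_eq_zero]

/-- A_i v is supported on spheres i-1 to i+1 and A_{i+2} v on spheres i+1 to i+3, so only sphere i+1
contributes. -/
theorem distMatrix_dotProduct_eq_sum_upVec_downVec (hc : G.Connected)
    (hv : ∀ z, G.dist x z ≠ 1 → v z = 0) (hs : ∑ z, v z = 0) (i : ℕ) :
    (distMatrix G i *ᵥ v) ⬝ᵥ star (distMatrix G (i + 2) *ᵥ v) =
      ∑ y ∈ Finset.univ.filter (fun y => G.dist x y = i + 1),
        upVec G x v y * star (downVec G x v y) := by
  rw [dotProduct, Finset.sum_filter]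
  refine Finset.sum_congr rfl fun y _ => ?_
  split_ifs with h
  · rw [Pi.star_apply, distMatrix_mulVec_apply_of_lt hc hv hs h,
      distMatrix_mulVec_apply_of_gt hc hv hs (by omega)]
  · obtain h | h : G.dist x y + 1 < i + 2 ∨ i + 1 < G.dist x y := by omega
    · rw [Pi.star_apply, distMatrix_mulVec_apply_eq_zero hc hv hs (Or.inl h), star_zero, mul_zero]
    · rw [distMatrix_mulVec_apply_eq_zero hc hv hs (Or.inr h), zero_mul]

theorem downVec_ne_zero_or_upVec_ne_zero (hG : IsDistanceRegular G)
    (hv0 : v ≠ 0) (hv : ∀ z, G.dist x z ≠ 1 → v z = 0) (hs : ∑ z, v z = 0)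
    (hl : localForm G x v = 0) {i : ℕ} (hi : i + 1 ≤ G.diam) :
    ∃ y, (G.dist x y = i ∧ downVec G x v y ≠ 0) ∨
      (G.dist x y = i + 1 ∧ upVec G x v y ≠ 0) := by
  have hc := hG.connected
  obtain ⟨y, -, hy⟩ := Finset.exists_ne_zero_of_sum_ne_zero
    (dotProduct_ne_zero_of_localForm_eq_zero hG hv0 hv hs hl hi)
  have h1 := left_ne_zero_of_mul hy
  have h2 := right_ne_zero_of_mul hy
  rw [Pi.star_apply, star_ne_zero] at h2
  refine ⟨y, ?_⟩
  obtain h | h | h | h : G.dist x y + 1 < i + 1 ∨ i + 1 < G.dist x y ∨ G.dist x y = i ∨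
    G.dist x y = i + 1 := by omega
  · exact (h2 (distMatrix_mulVec_apply_eq_zero hc hv hs (Or.inl h))).elim
  · exact (h1 (distMatrix_mulVec_apply_eq_zero hc hv hs (Or.inr h))).elim
  · rw [distMatrix_mulVec_apply_of_gt hc hv hs (by omega)] at h2
    exact Or.inl ⟨h, h2⟩
  · rw [distMatrix_mulVec_apply_of_lt hc hv hs h] at h1
    exact Or.inr ⟨h, h1⟩

/-! ### Proportionality of the down part to the up part -/

/-- Evaluate A_1 A_{i+2} v at y in two ways: the expansion gives a nonzero multiple of down(y),
while the sum over neighbours of y only sees down on sphere i+1. -/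
theorem downVec_eq_zero_of_succ (hG : IsDistanceRegular G)
    (hv : ∀ z, G.dist x z ≠ 1 → v z = 0) (hs : ∑ z, v z = 0) {i : ℕ} (hi : i + 2 ≤ G.diam)
    (h : ∀ y, G.dist x y = i + 1 → downVec G x v y = 0) {y : X} (hy : G.dist x y = i) :
    downVec G x v y = 0 := by
  have hc := hG.connected
  obtain ⟨f, hf, hf0⟩ := exists_distMatrix_mul hG 1 (i + 2)
  have h1 : f i = 0 := by
    by_contra hcon
    have := triangle_of_ne_zero hG hf0 (by omega) hcon
    omega
  have h2 : f (i - 1) = 0 := by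
    by_contra hcon
    have := triangle_of_ne_zero hG hf0 (by omega) hcon
    omega
  have h3 : f (i + 1) ≠ 0 := by
    obtain ⟨a, b, hab⟩ := exists_dist_eq hc hi
    obtain ⟨w, haw, hwb⟩ := exists_dist_eq_and_dist_eq hc (m := 1) (n := i + 1)
      (hab.trans (by omega))
    rw [← hwb, hf0]
    exact ⟨a, G.dist_comm ▸ haw, hab⟩
  have key := radial_mulVec_apply hc hv hs f y
  rw [hy, h1, h2, ← hf, ← Matrix.mulVec_mulVec] at key
  have hzero : (distMatrix G 1 *ᵥ (distMatrix G (i + 2) *ᵥ v)) y = 0 := by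
    refine Finset.sum_eq_zero fun z _ => ?_
    dsimp only
    rw [distMatrix_apply]
    split_ifs with hyz
    · have := hc.dist_triangle (u := x) (v := y) (w := z)
      obtain hz | hz : G.dist x z = i + 1 ∨ G.dist x z + 1 < i + 2 := by omega
      · rw [distMatrix_mulVec_apply_of_gt hc hv hs (by omega), h z hz, mul_zero]
      · rw [distMatrix_mulVec_apply_eq_zero hc hv hs (Or.inl hz), mul_zero]
    · rw [zero_mul]
  rw [hzero] at key
  simpa [h3] using key.symm

theorem exists_downVec_eq_mul_upVec (hG : IsDistanceRegular G)
    (hv0 : v ≠ 0) (hv : ∀ z, G.dist x z ≠ 1 → v z = 0) (hs : ∑ z, v z = 0) (δ : ℕ → ℂ)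
    (hδ : ∀ y, 1 ≤ G.dist x y → G.dist x y < G.diam →
      δ (G.dist x y) * upVec G x v y = δ (G.dist x y + 1) * downVec G x v y)
    (hδ0 : ∃ i, 1 ≤ i ∧ i ≤ G.diam ∧ δ i ≠ 0) :
    (∀ i, 1 ≤ i → i < G.diam → ∃ y, G.dist x y = i ∧ upVec G x v y ≠ 0) ∧
      ∃ μ : ℕ → ℂ, ∀ y, downVec G x v y = μ (G.dist x y) * upVec G x v y := by
  have hc := hG.connected
  obtain ⟨k, hk1, hkD, hk⟩ := hδ0
  obtain ⟨y₁, hy₁⟩ := Function.ne_iff.1 hv0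
  have hxy₁ : G.dist x y₁ = 1 := by
    by_contra h
    exact hy₁ (hv _ h)
  have hup₁ : upVec G x v y₁ ≠ 0 := by rwa [upVec_eq_self hc hxy₁]
  by_cases hl : localForm G x v = 0
  -- Here up and down are orthogonal on each inner sphere, so pairing the relation with down gives
  -- δ(i+1) ‖down‖² = 0 there.
  · have horth : ∀ y, 1 ≤ G.dist x y → G.dist x y < G.diam →
        δ (G.dist x y + 1) * downVec G x v y = 0 := by
      intro y hy1 hyD
      obtain ⟨i, hi⟩ := Nat.exists_eq_add_of_le' hy1
      obtain ⟨c, -, h⟩ := exists_dotProduct_eq_mul_localForm hG hv hs (i := i) (by omega)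
      rw [hl, mul_zero, distMatrix_dotProduct_eq_sum_upVec_downVec hc hv hs] at h
      have h2 : δ (i + 2) * ∑ y ∈ Finset.univ.filter (fun y => G.dist x y = i + 1),
          downVec G x v y * star (downVec G x v y) = 0 := by
        rw [← mul_zero (δ (i + 1)), ← h, Finset.mul_sum, Finset.mul_sum]
        refine Finset.sum_congr rfl fun z hz => ?_
        have hz := (Finset.mem_filter.1 hz).2
        have := hδ z (by omega) (by omega)
        rw [hz] at this
        rw [← mul_assoc, ← mul_assoc, this]
      rw [hi]
      refine mul_eq_zero.2 ((mul_eq_zero.1 h2).imp_right fun h3 => ?_)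
      have h4 := (Finset.sum_eq_zero_iff_of_nonneg (fun z _ => mul_star_self_nonneg _)).1 h3 y
        (by simp [hi])
      simpa using h4
    have hup : ∀ y, 1 ≤ G.dist x y → G.dist x y < G.diam →
        δ (G.dist x y) * upVec G x v y = 0 := fun y h1 h2 => (hδ y h1 h2).trans (horth y h1 h2)
    -- Down on sphere i-1 or up on sphere i is nonzero, since ⟨A_{i-1} v, A_i v⟩ ≠ 0; either one
    -- forces δ(i) = 0.
    have hzero : ∀ i, 1 ≤ i → i < G.diam → δ i = 0 := by
      intro i hi hiD
      obtain rfl | ⟨j, hj, rfl⟩ : i = 1 ∨ ∃ j, 1 ≤ j ∧ i = j + 1 := by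
        rcases Nat.eq_or_lt_of_le hi with h | h
        · exact Or.inl h.symm
        · exact Or.inr ⟨i - 1, by omega, by omega⟩
      · have := hup y₁ (by omega) (by omega)
        rw [hxy₁] at this
        exact (mul_eq_zero.1 this).resolve_right hup₁
      · obtain ⟨y, ⟨hy, hne⟩ | ⟨hy, hne⟩⟩ :=
          downVec_ne_zero_or_upVec_ne_zero hG hv0 hv hs hl hiD.le
        · have := horth y (by omega) (by omega)
          rw [hy] at this
          exact (mul_eq_zero.1 this).resolve_right hne
        · have := hup y (by omega) (by omega)
          rw [hy] at this
          exact (mul_eq_zero.1 this).resolve_right hne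
    obtain rfl : k = G.diam := by
      by_contra h
      exact hk (hzero k hk1 (by omega))
    -- δ(D) ≠ 0 makes down vanish on sphere D-1, and the vanishing propagates inwards.
    have hdown : ∀ n, ∀ y, G.dist x y + n = G.diam → downVec G x v y = 0 := by
      intro n
      induction n with
      | zero => exact fun y hy => downVec_eq_zero hc hy
      | succ n ih =>
        intro y hy
        rcases Nat.eq_zero_or_pos (G.dist x y) with h0 | h0
        · exact downVec_self hc hv hs h0
        rcases Nat.eq_zero_or_pos n with rfl | hn
        · have := horth y h0 (by omega)
          rw [hy] at this
          exact (mul_eq_zero.1 this).resolve_left hk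
        · exact downVec_eq_zero_of_succ hG hv hs (i := G.dist x y) (by omega)
            (fun z hz => ih z (by omega)) rfl
    have hdown' : ∀ y, downVec G x v y = 0 := fun y =>
      hdown (G.diam - G.dist x y) y (by have := dist_le_diam_of_connected hc x y; omega)
    refine ⟨fun i hi hiD => ?_, 0, fun y => by simp [hdown' y]⟩
    obtain ⟨j, rfl⟩ := Nat.exists_eq_add_of_le' hi
    obtain ⟨y, ⟨hy, hne⟩ | h⟩ :=
      downVec_ne_zero_or_upVec_ne_zero hG hv0 hv hs hl hiD.le
    · exact (hne (hdown' y)).elim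
    · exact ⟨y, h⟩
  -- Now ⟨up, down⟩ ≠ 0 on every inner sphere, so neither part vanishes there and all δ(i) are
  -- nonzero together.
  · have hne : ∀ i, 1 ≤ i → i < G.diam →
        ∃ y, G.dist x y = i ∧ upVec G x v y ≠ 0 ∧ downVec G x v y ≠ 0 := by
      intro i hi hiD
      obtain ⟨j, rfl⟩ := Nat.exists_eq_add_of_le' hi
      obtain ⟨c, hc0, h⟩ := exists_dotProduct_eq_mul_localForm hG hv hs (i := j) (by omega)
      have h := h.trans_ne (mul_ne_zero hc0 hl)
      rw [distMatrix_dotProduct_eq_sum_upVec_downVec hc hv hs] at h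
      obtain ⟨y, hy, hy0⟩ := Finset.exists_ne_zero_of_sum_ne_zero h
      exact ⟨y, (Finset.mem_filter.1 hy).2, left_ne_zero_of_mul hy0,
        star_ne_zero.1 (right_ne_zero_of_mul hy0)⟩
    have hstep : ∀ i, 1 ≤ i → i < G.diam → (δ i = 0 ↔ δ (i + 1) = 0) := by
      intro i hi hiD
      obtain ⟨y, rfl, h1, h2⟩ := hne i hi hiD
      have := hδ y hi hiD
      constructor <;> intro h0 <;> simpa [h0, h1, h2] using this
    have hall : ∀ i, 1 ≤ i → i ≤ G.diam → (δ i = 0 ↔ δ 1 = 0) := by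
      intro i hi
      induction i, hi using Nat.le_induction with
      | base => exact fun _ => Iff.rfl
      | succ i hi ih => exact fun h => (hstep i hi (by omega)).symm.trans (ih (by omega))
    have hδne : ∀ i, 1 ≤ i → i ≤ G.diam → δ i ≠ 0 := fun i hi hiD h =>
      hk ((hall k hk1 hkD).2 ((hall i hi hiD).1 h))
    refine ⟨fun i hi hiD => ?_, fun i => if i < G.diam then δ i / δ (i + 1) else 0, fun y => ?_⟩
    · obtain ⟨y, hy, h, -⟩ := hne i hi hiD
      exact ⟨y, hy, h⟩
    · rcases Nat.eq_zero_or_pos (G.dist x y) with h0 | h0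
      · rw [downVec_self hc hv hs h0, upVec_eq_zero h0, mul_zero]
      · dsimp only
        split_ifs with h
        · rw [div_mul_eq_mul_div, hδ y h0 h, mul_div_cancel_left₀ _ (hδne _ (by omega) (by omega))]
        · have := dist_le_diam_of_connected hc x y
          rw [downVec_eq_zero hc (by omega), zero_mul]

end DRG

/-! ### The thin module generated by v -/

namespace DRG

open scoped Matrix ComplexOrder

variable {X : Type*} [Fintype X] {G : SimpleGraph X} {x : X} {v : X → ℂ}

theorem radial_mulVec_apply_eq_mul_upVec (hc : G.Connected)
    (hv : ∀ z, G.dist x z ≠ 1 → v z = 0) (hs : ∑ z, v z = 0) {μ : ℕ → ℂ}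
    (hμ : ∀ y, downVec G x v y = μ (G.dist x y) * upVec G x v y) (ρ : ℕ → ℂ) (y : X) :
    (radial G ρ *ᵥ v) y = ((ρ (G.dist x y - 1) - ρ (G.dist x y)) +
      (ρ (G.dist x y + 1) - ρ (G.dist x y)) * μ (G.dist x y)) * upVec G x v y := by
  rw [radial_mulVec_apply hc hv hs, hμ]
  ring

/-- The span of the vectors `E_i^* A_{i-1} v`. -/
noncomputable def upModule (G : SimpleGraph X) (x : X) (v : X → ℂ) : Submodule ℂ (X → ℂ) where
  carrier := {w | ∃ c : ℕ → ℂ, ∀ y, w y = c (G.dist x y) * upVec G x v y}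
  zero_mem' := ⟨0, by simp⟩
  add_mem' := by
    rintro _ _ ⟨c, hc⟩ ⟨d, hd⟩
    exact ⟨c + d, fun y => by simp [hc, hd, add_mul]⟩
  smul_mem' := by
    rintro r _ ⟨c, hc⟩
    exact ⟨r • c, fun y => by simp [hc, mul_assoc]⟩

theorem radial_mulVec_mem_upModule (hc : G.Connected)
    (hv : ∀ z, G.dist x z ≠ 1 → v z = 0) (hs : ∑ z, v z = 0) {μ : ℕ → ℂ}
    (hμ : ∀ y, downVec G x v y = μ (G.dist x y) * upVec G x v y) (ρ : ℕ → ℂ) :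
    radial G ρ *ᵥ v ∈ upModule G x v :=
  ⟨fun d => (ρ (d - 1) - ρ d) + (ρ (d + 1) - ρ d) * μ d,
    radial_mulVec_apply_eq_mul_upVec hc hv hs hμ ρ⟩

variable [DecidableEq X]

theorem dualIdempotent_mulVec_apply (i : ℕ) (w : X → ℂ) (y : X) :
    (dualIdempotent G x i *ᵥ w) y = if G.dist x y = i then w y else 0 := by
  simp [dualIdempotent, Matrix.mulVec_diagonal]

theorem mem_subconstituent {i : ℕ} {w : X → ℂ} :
    w ∈ subconstituent G x i ↔ ∀ y, G.dist x y ≠ i → w y = 0 := by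
  constructor
  · rintro ⟨u, -, rfl⟩ y hy
    rw [Matrix.mulVecLin_apply, dualIdempotent_mulVec_apply, if_neg hy]
  · intro h
    refine ⟨w, trivial, ?_⟩
    ext y
    rw [Matrix.mulVecLin_apply, dualIdempotent_mulVec_apply]
    split_ifs with hy
    · rfl
    · exact (h y hy).symm

theorem sum_eq_zero_of_hermInner_sphereVec (hv : ∀ z, G.dist x z ≠ 1 → v z = 0)
    (h : hermInner v (sphereVec G x 1) = 0) : ∑ z, v z = 0 := by
  rw [← h, hermInner, dotProduct]
  refine Finset.sum_congr rfl fun z _ => ?_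
  by_cases hz : G.dist x z = 1
  · simp [sphereVec, Finset.sum_apply, Pi.single_apply, hz]
  · simp [hv z hz]

section TModule

variable [DecidableRel G.Adj]

theorem dualIdempotent_mem_terwilliger {i : ℕ} (hi : i ≤ G.diam) :
    dualIdempotent G x i ∈ terwilliger G x :=
  Algebra.subset_adjoin (Or.inr ⟨i, hi, rfl⟩)

theorem boseMesner_le_terwilliger : boseMesner G ≤ terwilliger G x :=
  Algebra.adjoin_mono Set.subset_union_left

theorem isTModule_of_generators {W : Submodule ℂ (X → ℂ)}
    (hA : ∀ w ∈ W, G.adjMatrix ℂ *ᵥ w ∈ W) (hE : ∀ i, ∀ w ∈ W, dualIdempotent G x i *ᵥ w ∈ W) :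
    IsTModule G x W := by
  intro B hB
  refine Algebra.adjoin_induction ?_ ?_ ?_ ?_ hB
  · rintro _ (rfl | ⟨i, -, rfl⟩)
    exacts [hA, hE i]
  · intro r w hw
    rw [Algebra.algebraMap_eq_smul_one, Matrix.smul_mulVec, Matrix.one_mulVec]
    exact W.smul_mem r hw
  · intro B C _ _ hB hC w hw
    rw [Matrix.add_mulVec]
    exact add_mem (hB w hw) (hC w hw)
  · intro B C _ _ hB hC w hw
    rw [← Matrix.mulVec_mulVec]
    exact hB _ (hC w hw)

end TModule

theorem eq_sum_of_mem_upModule (hc : G.Connected) {w : X → ℂ} {c : ℕ → ℂ}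
    (h : ∀ y, w y = c (G.dist x y) * upVec G x v y) :
    w = ∑ i ∈ Finset.range (G.diam + 1), c i • (dualIdempotent G x i *ᵥ upVec G x v) := by
  ext y
  have := dist_le_diam_of_connected hc x y
  simp [Finset.sum_apply, dualIdempotent_mulVec_apply, h, this]

theorem dualIdempotent_mulVec_mem_upModule (i : ℕ) {w : X → ℂ} (hw : w ∈ upModule G x v) :
    dualIdempotent G x i *ᵥ w ∈ upModule G x v := by
  obtain ⟨c, h⟩ := hw
  refine ⟨fun j => if j = i then c j else 0, fun y => ?_⟩
  rw [dualIdempotent_mulVec_apply, h]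
  split_ifs with hy <;> simp [hy]

theorem dualIdempotent_mulVec_upVec (hc : G.Connected)
    (hv : ∀ z, G.dist x z ≠ 1 → v z = 0) (hs : ∑ z, v z = 0) (i : ℕ) :
    dualIdempotent G x (i + 1) *ᵥ upVec G x v =
      dualIdempotent G x (i + 1) *ᵥ (distMatrix G i *ᵥ v) := by
  ext y
  rw [dualIdempotent_mulVec_apply, dualIdempotent_mulVec_apply]
  split_ifs with h
  · rw [distMatrix_mulVec_apply_of_lt hc hv hs h]
  · rfl

theorem dualIdempotent_zero_mulVec_upVec : dualIdempotent G x 0 *ᵥ upVec G x v = 0 := by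
  ext y
  rw [dualIdempotent_mulVec_apply]
  split_ifs with h
  · exact upVec_eq_zero h
  · rfl

theorem dualIdempotent_one_mulVec_upVec (hc : G.Connected)
    (hv : ∀ z, G.dist x z ≠ 1 → v z = 0) : dualIdempotent G x 1 *ᵥ upVec G x v = v := by
  ext y
  rw [dualIdempotent_mulVec_apply]
  split_ifs with h
  · exact upVec_eq_self hc h
  · exact (hv y h).symm

/-- E_{k+1}^* up is A_k v minus a combination of earlier E_i^* up. Apply A: A A_k v is again a
member of `M` applied to v, and the rest is covered by induction. -/
theorem distMatrix_one_mulVec_dualIdempotent_mem (hG : IsDistanceRegular G)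
    (hv : ∀ z, G.dist x z ≠ 1 → v z = 0) (hs : ∑ z, v z = 0) {μ : ℕ → ℂ}
    (hμ : ∀ y, downVec G x v y = μ (G.dist x y) * upVec G x v y) (i : ℕ) :
    distMatrix G 1 *ᵥ (dualIdempotent G x i *ᵥ upVec G x v) ∈ upModule G x v := by
  have hc := hG.connected
  induction i using Nat.strong_induction_on with
  | _ i ih =>
  rcases i with _ | k
  · rw [dualIdempotent_zero_mulVec_upVec, Matrix.mulVec_zero]
    exact zero_mem _
  · set ρ : ℕ → ℂ := Pi.single k 1
    set c : ℕ → ℂ := fun d => (ρ (d - 1) - ρ d) + (ρ (d + 1) - ρ d) * μ d with hcdef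
    have hc1 : c (k + 1) = 1 := by
      have : k + 1 + 1 ≠ k := by omega
      simp [hcdef, ρ, this]
    have hc0 : ∀ d, k + 1 < d → c d = 0 := by
      intro d hd
      have h1 : d - 1 ≠ k := by omega
      have h2 : d ≠ k := by omega
      have h3 : d + 1 ≠ k := by omega
      simp [hcdef, ρ, h1, h2, h3]
    have key : dualIdempotent G x (k + 1) *ᵥ upVec G x v = radial G ρ *ᵥ v -
        ∑ i ∈ Finset.range (k + 1), c i • (dualIdempotent G x i *ᵥ upVec G x v) := by
      rw [eq_sub_iff_add_eq']
      ext y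
      rw [radial_mulVec_apply_eq_mul_upVec hc hv hs hμ ρ y]
      change _ = c (G.dist x y) * _
      simp only [Pi.add_apply, Finset.sum_apply, Pi.smul_apply, dualIdempotent_mulVec_apply,
        smul_eq_mul, mul_ite, mul_zero, Finset.sum_ite_eq, Finset.mem_range]
      obtain h | h | h := lt_trichotomy (G.dist x y) (k + 1)
      · simp [h, h.ne]
      · simp [h, hc1]
      · simp [h.not_gt, h.ne', hc0 _ h]
    rw [key, Matrix.mulVec_sub, Matrix.mulVec_mulVec]
    obtain ⟨τ, hτ⟩ := exists_radial_mul hG (Pi.single 1 1) ρ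
    rw [distMatrix, hτ]
    refine sub_mem (radial_mulVec_mem_upModule hc hv hs hμ τ) ?_
    rw [Matrix.mulVec_sum]
    refine sum_mem fun i hi => ?_
    rw [Matrix.mulVec_smul]
    exact Submodule.smul_mem _ _ (ih i (Finset.mem_range.1 hi))

theorem mem_upModule_self (hc : G.Connected) (hv : ∀ z, G.dist x z ≠ 1 → v z = 0) :
    v ∈ upModule G x v := by
  have h := dualIdempotent_mulVec_mem_upModule 1 (w := upVec G x v) (v := v) (G := G) (x := x)
    ⟨1, by simp⟩
  rwa [dualIdempotent_one_mulVec_upVec hc hv] at h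

theorem dualIdempotent_mulVec_eq_smul {i : ℕ} {w : X → ℂ} (hw : w ∈ upModule G x v) :
    ∃ r : ℂ, dualIdempotent G x i *ᵥ w = r • (dualIdempotent G x i *ᵥ upVec G x v) := by
  obtain ⟨c, h⟩ := hw
  refine ⟨c i, ?_⟩
  ext y
  rw [Pi.smul_apply, dualIdempotent_mulVec_apply, dualIdempotent_mulVec_apply, h]
  split_ifs with hy <;> simp [hy]

omit [Fintype X] in
theorem dualIdempotent_conjTranspose (i : ℕ) :
    (dualIdempotent G x i)ᴴ = dualIdempotent G x i := by
  rw [dualIdempotent, Matrix.diagonal_conjTranspose]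
  congr 1
  ext y
  rw [Pi.star_apply]
  split_ifs <;> simp

theorem isThin_upModule : IsThin G x (upModule G x v) := by
  intro i _
  refine (Submodule.finrank_mono (t := ℂ ∙ (dualIdempotent G x i *ᵥ upVec G x v)) ?_).trans
    ((finrank_span_le_card _).trans (by simp))
  rintro _ ⟨w, hw, rfl⟩
  obtain ⟨r, hr⟩ := dualIdempotent_mulVec_eq_smul (i := i) hw
  exact Submodule.mem_span_singleton.2 ⟨r, hr.symm⟩

theorem hasEndpoint_upModule (hc : G.Connected) (hD : 1 ≤ G.diam) (hv0 : v ≠ 0)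
    (hv : ∀ z, G.dist x z ≠ 1 → v z = 0) : HasEndpoint G x (upModule G x v) 1 := by
  refine ⟨⟨hD, fun h => hv0 ?_⟩, ?_⟩
  · have : v ∈ dualPart G x 1 (upModule G x v) :=
      ⟨upVec G x v, ⟨1, by simp⟩, dualIdempotent_one_mulVec_upVec hc hv⟩
    simpa [h] using this
  · rintro i ⟨-, hi⟩
    by_contra! h
    obtain rfl : i = 0 := by omega
    refine hi ((Submodule.eq_bot_iff _).2 ?_)
    rintro _ ⟨w, hw, rfl⟩
    obtain ⟨r, hr⟩ := dualIdempotent_mulVec_eq_smul (i := 0) hw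
    rw [Matrix.mulVecLin_apply, hr, dualIdempotent_zero_mulVec_upVec, smul_zero]

variable [DecidableRel G.Adj]

theorem isTModule_upModule (hG : IsDistanceRegular G)
    (hv : ∀ z, G.dist x z ≠ 1 → v z = 0) (hs : ∑ z, v z = 0) {μ : ℕ → ℂ}
    (hμ : ∀ y, downVec G x v y = μ (G.dist x y) * upVec G x v y) :
    IsTModule G x (upModule G x v) := by
  refine isTModule_of_generators ?_ fun i w => dualIdempotent_mulVec_mem_upModule i
  rintro w ⟨c, hw⟩
  rw [adjMatrix_eq, eq_sum_of_mem_upModule hG.connected hw, Matrix.mulVec_sum]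
  refine sum_mem fun i _ => ?_
  rw [Matrix.mulVec_smul]
  exact Submodule.smul_mem _ _ (distMatrix_one_mulVec_dualIdempotent_mem hG hv hs hμ i)

theorem dualIdempotent_mulVec_upVec_mem (hG : IsDistanceRegular G)
    (hv : ∀ z, G.dist x z ≠ 1 → v z = 0) (hs : ∑ z, v z = 0) {U : Submodule ℂ (X → ℂ)}
    (hU : IsTModule G x U) (hvU : v ∈ U) {i : ℕ} (hi : i ≤ G.diam) :
    dualIdempotent G x i *ᵥ upVec G x v ∈ U := by
  rcases i with _ | i
  · rw [dualIdempotent_zero_mulVec_upVec]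
    exact zero_mem _
  · rw [dualIdempotent_mulVec_upVec hG.connected hv hs]
    exact hU _ (dualIdempotent_mem_terwilliger hi) _
      (hU _ (boseMesner_le_terwilliger (distMatrix_mem_boseMesner hG (by omega))) _ hvU)

theorem upModule_le (hG : IsDistanceRegular G)
    (hv : ∀ z, G.dist x z ≠ 1 → v z = 0) (hs : ∑ z, v z = 0) {U : Submodule ℂ (X → ℂ)}
    (hU : IsTModule G x U) (hvU : v ∈ U) : upModule G x v ≤ U := by
  rintro w ⟨c, hw⟩
  rw [eq_sum_of_mem_upModule hG.connected hw]
  exact sum_mem fun i hi => Submodule.smul_mem _ _ (dualIdempotent_mulVec_upVec_mem hG hv hs hU hvU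
    (Nat.lt_succ_iff.1 (Finset.mem_range.1 hi)))

/-- A submodule containing v is everything. Otherwise E_1^* kills it, since E_1^* of the module is
the line through v; taking adjoints, it is then orthogonal to every E_i^* A_{i-1} v, hence to
itself. -/
theorem isIrreducibleTModule_upModule (hG : IsDistanceRegular G) (hD : 1 ≤ G.diam) (hv0 : v ≠ 0)
    (hv : ∀ z, G.dist x z ≠ 1 → v z = 0) (hs : ∑ z, v z = 0) {μ : ℕ → ℂ}
    (hμ : ∀ y, downVec G x v y = μ (G.dist x y) * upVec G x v y) :
    IsIrreducibleTModule G x (upModule G x v) := by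
  have hc := hG.connected
  refine ⟨isTModule_upModule hG hv hs hμ, fun h => hv0 ?_, fun U hUW hU => ?_⟩
  · simpa [h] using mem_upModule_self hc hv
  by_cases hvU : v ∈ U
  · exact Or.inr (le_antisymm hUW (upModule_le hG hv hs hU hvU))
  refine Or.inl ((Submodule.eq_bot_iff U).2 fun u hu => ?_)
  have hE1 : ∀ w ∈ U, dualIdempotent G x 1 *ᵥ w = 0 := by
    intro w hw
    obtain ⟨r, hr⟩ := dualIdempotent_mulVec_eq_smul (i := 1) (hUW hw)
    rw [dualIdempotent_one_mulVec_upVec hc hv] at hr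
    have hmem := hU _ (dualIdempotent_mem_terwilliger hD) w hw
    rw [hr] at hmem ⊢
    by_cases hr0 : r = 0
    · rw [hr0, zero_smul]
    · exact (hvU ((Submodule.smul_mem_iff U hr0).1 hmem)).elim
  have hEv : dualIdempotent G x 1 *ᵥ v = v := by
    ext y
    rw [dualIdempotent_mulVec_apply]
    split_ifs with h
    · rfl
    · exact (hv y h).symm
  have horth : ∀ i ≤ G.diam, (dualIdempotent G x i *ᵥ upVec G x v) ⬝ᵥ star u = 0 := by
    intro i hi
    rcases i with _ | i
    · rw [dualIdempotent_zero_mulVec_upVec, zero_dotProduct]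
    · have h := hE1 _ (hU _ (boseMesner_le_terwilliger
        (distMatrix_mem_boseMesner hG (i := i) (by omega))) _
        (hU _ (dualIdempotent_mem_terwilliger hi) u hu))
      have h1 := mulVec_dotProduct_star_mulVec (dualIdempotent G x (i + 1)) 1
        (distMatrix G i *ᵥ v) u
      rw [dualIdempotent_conjTranspose, mul_one, Matrix.one_mulVec] at h1
      rw [dualIdempotent_mulVec_upVec hc hv hs, h1, mulVec_dotProduct_star_mulVec,
        distMatrix_conjTranspose, ← Matrix.mulVec_mulVec]
      -- Writing v = E_1^* v lets E_1^* move to the other side, where it annihilates a vector of U.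
      nth_rewrite 1 [← hEv]
      have h2 := mulVec_dotProduct_star_mulVec (dualIdempotent G x 1) 1 v
        (distMatrix G i *ᵥ (dualIdempotent G x (i + 1) *ᵥ u))
      rw [dualIdempotent_conjTranspose, mul_one, Matrix.one_mulVec, h] at h2
      rw [h2, star_zero, dotProduct_zero]
  obtain ⟨c, hw⟩ := hUW hu
  refine dotProduct_self_star_eq_zero.1 ?_
  nth_rewrite 1 [eq_sum_of_mem_upModule hc hw]
  rw [sum_dotProduct]
  refine Finset.sum_eq_zero fun i hi => ?_
  rw [smul_dotProduct, horth i (Nat.lt_succ_iff.1 (Finset.mem_range.1 hi)), smul_zero]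

/-! ### The dimension of (M; v) -/

theorem mul_upVec_eq_mul_downVec_of_mem_pairSpace (hc : G.Connected)
    (hv : ∀ z, G.dist x z ≠ 1 → v z = 0) (hs : ∑ z, v z = 0) {ρ : ℕ → ℂ}
    (hρ : radial G ρ ∈ pairSpace G x v) {y : X} (hy : G.dist x y ≠ G.diam) :
    (ρ (G.dist x y - 1) - ρ (G.dist x y)) * upVec G x v y =
      (ρ (G.dist x y) - ρ (G.dist x y + 1)) * downVec G x v y := by
  have h := mem_subconstituent.1 hρ.2 y hy
  rw [radial_mulVec_apply hc hv hs] at h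
  linear_combination h

/-- If every ρ were constant on 0, …, D, the space would lie in the line spanned by the all-ones
matrix. -/
theorem exists_radial_mem_pairSpace (hG : IsDistanceRegular G)
    (h : 2 ≤ Module.finrank ℂ (pairSpace G x v)) :
    ∃ ρ, radial G ρ ∈ pairSpace G x v ∧ ∃ i, 1 ≤ i ∧ i ≤ G.diam ∧ ρ (i - 1) - ρ i ≠ 0 := by
  by_contra! hcon
  have hle : pairSpace G x v ≤ ℂ ∙ radial G 1 := by
    intro P hP
    obtain ⟨ρ, rfl⟩ := exists_eq_radial_of_mem_boseMesner hG hP.1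
    have hconst : ∀ i ≤ G.diam, ρ i = ρ 0 := by
      intro i hi
      induction i with
      | zero => rfl
      | succ i ih =>
        have := hcon ρ hP (i + 1) (by omega) hi
        rw [Nat.add_sub_cancel, sub_eq_zero] at this
        rw [← this, ih (by omega)]
    refine Submodule.mem_span_singleton.2 ⟨ρ 0, ?_⟩
    ext y z
    simp [hconst _ (dist_le_diam_of_connected hG.connected y z)]
  have h1 := (Submodule.finrank_mono hle).trans ((finrank_span_le_card _).trans (by simp : _ ≤ 1))
  omega

/-- Where up ≠ 0, the relation on sphere i determines ρ(i-1) from ρ(i) and ρ(i+1), so entries at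
distances D and D-1 determine P. -/
theorem finrank_pairSpace_le_two (hG : IsDistanceRegular G)
    (hv : ∀ z, G.dist x z ≠ 1 → v z = 0) (hs : ∑ z, v z = 0)
    (hup : ∀ i, 1 ≤ i → i < G.diam → ∃ y, G.dist x y = i ∧ upVec G x v y ≠ 0) :
    Module.finrank ℂ (pairSpace G x v) ≤ 2 := by
  have hc := hG.connected
  obtain ⟨a, b, hab⟩ := exists_dist_eq hc (le_refl G.diam)
  obtain ⟨a', b', hab'⟩ := exists_dist_eq hc (Nat.sub_le G.diam 1)
  let φ : pairSpace G x v →ₗ[ℂ] ℂ × ℂ :=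
    { toFun := fun P => ((P : Matrix X X ℂ) a b, (P : Matrix X X ℂ) a' b')
      map_add' := fun P Q => rfl
      map_smul' := fun r P => rfl }
  have hφ : Function.Injective φ := by
    rw [injective_iff_map_eq_zero]
    rintro ⟨P, hP⟩ h
    obtain ⟨ρ, rfl⟩ := exists_eq_radial_of_mem_boseMesner hG hP.1
    have h1 : ρ G.diam = 0 := by
      rw [← hab]
      exact congrArg Prod.fst h
    have h2 : ρ (G.diam - 1) = 0 := by
      rw [← hab']
      exact congrArg Prod.snd h
    have hzero : ∀ n, n + 1 ≤ G.diam → ρ (G.diam - n) = 0 ∧ ρ (G.diam - (n + 1)) = 0 := by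
      intro n
      induction n with
      | zero => exact fun _ => ⟨h1, h2⟩
      | succ n ih =>
        intro hn
        obtain ⟨h3, h4⟩ := ih (by omega)
        refine ⟨h4, ?_⟩
        obtain ⟨y, hy, hy0⟩ := hup (G.diam - (n + 1)) (by omega) (by omega)
        have hrel := mul_upVec_eq_mul_downVec_of_mem_pairSpace hc hv hs hP (y := y) (by omega)
        rw [hy, h4, show G.diam - (n + 1) + 1 = G.diam - n by omega, h3, sub_zero, sub_zero,
          zero_mul] at hrel
        exact (mul_eq_zero.1 hrel).resolve_right hy0
    refine Subtype.ext ?_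
    ext y z
    have hle := dist_le_diam_of_connected hc y z
    change ρ (G.dist y z) = 0
    rcases hle.eq_or_lt with h | h
    · rw [h, h1]
    · have := (hzero (G.diam - (G.dist y z + 1)) (by omega)).2
      rw [show G.diam - (G.diam - (G.dist y z + 1) + 1) = G.dist y z by omega] at this
      exact this
  have := LinearMap.finrank_le_finrank_of_injective hφ
  simpa using this

theorem two_le_finrank_pairSpace (hG : IsDistanceRegular G)
    {W : Submodule ℂ (X → ℂ)} (hW : IsTModule G x W) (hthin : IsThin G x W)
    (hend : HasEndpoint G x W 1) (hvW : v ∈ W) :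
    2 ≤ Module.finrank ℂ (pairSpace G x v) := by
  have hc := hG.connected
  have hD : 1 ≤ G.diam := hend.1.1
  have hmem : ∀ P : boseMesner G, (P : Matrix X X ℂ) *ᵥ v ∈ W := fun P =>
    hW _ (boseMesner_le_terwilliger P.2) v hvW
  -- The index i stands for sphere i+1, covering 1, …, D-1: the endpoint handles sphere 0, and
  -- sphere D is unconstrained.
  let φ : boseMesner G →ₗ[ℂ] ((i : Fin (G.diam - 1)) → dualPart G x (i + 1) W) :=
    { toFun := fun P i => ⟨dualIdempotent G x (i + 1) *ᵥ ((P : Matrix X X ℂ) *ᵥ v),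
        ⟨_, hmem P, rfl⟩⟩
      map_add' := fun P Q => by
        ext i
        simp [Matrix.add_mulVec, Matrix.mulVec_add]
      map_smul' := fun r P => by
        ext i
        simp [Matrix.smul_mulVec, Matrix.mulVec_smul] }
  have hker : (LinearMap.ker φ).map (boseMesner G).val.toLinearMap ≤ pairSpace G x v := by
    rintro _ ⟨P, hP, rfl⟩
    refine ⟨P.2, mem_subconstituent.2 fun y hy => ?_⟩
    have hyD := dist_le_diam_of_connected hc x y
    have hval : ∀ i, dualIdempotent G x i *ᵥ ((P : Matrix X X ℂ) *ᵥ v) = 0 → G.dist x y = i →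
        ((P : Matrix X X ℂ) *ᵥ v) y = 0 := by
      intro i h hi
      have := congrFun h y
      rwa [dualIdempotent_mulVec_apply, if_pos hi] at this
    rcases Nat.eq_zero_or_pos (G.dist x y) with h0 | h0
    · refine hval 0 ?_ h0
      have hbot : dualPart G x 0 W = ⊥ := by
        by_contra hne
        have := hend.2 ⟨Nat.zero_le _, hne⟩
        omega
      have hm : dualIdempotent G x 0 *ᵥ ((P : Matrix X X ℂ) *ᵥ v) ∈ dualPart G x 0 W :=
        ⟨_, hmem P, rfl⟩
      rwa [hbot, Submodule.mem_bot] at hm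
    · refine hval _ ?_ (Nat.sub_add_cancel h0).symm
      have := congrFun (LinearMap.mem_ker.1 hP) ⟨G.dist x y - 1, by omega⟩
      exact congrArg Subtype.val this
  have h1 := Submodule.finrank_mono hker
  rw [← (Submodule.equivMapOfInjective (boseMesner G).val.toLinearMap Subtype.val_injective
    (LinearMap.ker φ)).finrank_eq] at h1
  have h2 := LinearMap.finrank_range_add_finrank_ker φ
  have h3 := diam_add_one_le_finrank_boseMesner hG
  have h4 : Module.finrank ℂ (LinearMap.range φ) ≤ G.diam - 1 := by
    refine (Submodule.finrank_le _).trans ?_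
    rw [Module.finrank_pi_fintype]
    have hle : ∀ i ∈ (Finset.univ : Finset (Fin (G.diam - 1))),
        Module.finrank ℂ (dualPart G x (i + 1) W) ≤ 1 := fun i _ => hthin (i + 1) (by omega)
    simpa using Finset.sum_le_card_nsmul _ _ 1 hle
  omega

end DRG

theorem theorem1p1 {X : Type*} [Fintype X] [DecidableEq X]
    (G : SimpleGraph X) [DecidableRel G.Adj]
    (hG : DRG.IsDistanceRegular G) (hD : 3 ≤ G.diam) (x : X)
    (v : X → ℂ) (hv0 : v ≠ 0) (hv1 : v ∈ DRG.subconstituent G x 1)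
    (hvs : DRG.hermInner v (DRG.sphereVec G x 1) = 0) :
    (2 ≤ Module.finrank ℂ (DRG.pairSpace G x v) ↔
      ∃ W : Submodule ℂ (X → ℂ), DRG.IsIrreducibleTModule G x W ∧ DRG.IsThin G x W ∧
        DRG.HasEndpoint G x W 1 ∧ v ∈ W) ∧
    (2 ≤ Module.finrank ℂ (DRG.pairSpace G x v) →
      Module.finrank ℂ (DRG.pairSpace G x v) = 2) := by
  have hc := hG.connected
  have hv := DRG.mem_subconstituent.1 hv1
  have hs := DRG.sum_eq_zero_of_hermInner_sphereVec hv hvs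
  have key : 2 ≤ Module.finrank ℂ (DRG.pairSpace G x v) →
      (∀ i, 1 ≤ i → i < G.diam → ∃ y, G.dist x y = i ∧ DRG.upVec G x v y ≠ 0) ∧
        ∃ μ : ℕ → ℂ, ∀ y, DRG.downVec G x v y = μ (G.dist x y) * DRG.upVec G x v y := by
    intro h
    obtain ⟨ρ, hρ, hne⟩ := DRG.exists_radial_mem_pairSpace hG h
    exact DRG.exists_downVec_eq_mul_upVec hG hv0 hv hs (fun i => ρ (i - 1) - ρ i)
      (fun y _ hyD => DRG.mul_upVec_eq_mul_downVec_of_mem_pairSpace hc hv hs hρ hyD.ne) hne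
  refine ⟨⟨fun h => ?_, ?_⟩, fun h => ?_⟩
  · obtain ⟨-, μ, hμ⟩ := key h
    exact ⟨DRG.upModule G x v,
      DRG.isIrreducibleTModule_upModule hG (by omega) hv0 hv hs hμ, DRG.isThin_upModule,
      DRG.hasEndpoint_upModule hc (by omega) hv0 hv, DRG.mem_upModule_self hc hv⟩
  · rintro ⟨W, hW, hthin, hend, hvW⟩
    exact DRG.two_le_finrank_pairSpace hG hW.isTModule hthin hend hvW
  · exact le_antisymm (DRG.finrank_pairSpace_le_two hG hv hs (key h).1) h
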